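/- Let $\mathcal C$ be a triangulated category with suspension $[1]$. For a $t$-structure $\mathcal E=(\mathcal E^{\le 0},\mathcal E^{\ge 0})$ on $\mathcal C$ put $\mathcal E^{\le m}=\mathcal E^{\le 0}[-m]$, $\mathcal E^{\ge m}=\mathcal E^{\ge 0}[-m]$, $\mathcal E^{[a,b]}=\mathcal E^{\ge a}\cap\mathcal E^{\le b}$, let $\mathcal H_{\mathcal E}=\mathcal E^{[0,0]}$ be its heart, and let $H^i_{\mathcal E}(X)=\tau_{\mathcal E}^{\ge 0}\tau_{\mathcal E}^{\le 0}(X[i])$ be its cohomological functors, where $\tau_{\mathcal E}^{\le 0},\tau_{\mathcal E}^{\ge 0}$ are the truncation functors. Let $(\mathcal D,\mathcal T)$ be a pair of $t$-structures on $\mathcal C$ that is - right filterable: for every $i\in\mathbb Z$ the class $\mathcal D^{\ge i}\cap\mathcal T^{\ge 0}$ is a co-aisle, i.e. equals $\mathcal E^{\ge 0}$ for some $t$-structure $\mathcal E$ on $\mathcal C$; - of type $(n,0)$ with $n\in\mathbb N$: $0$ is the maximal integer $k$ with $\mathcal T^{\le k}\subseteq\mathcal D^{\le 0}$, and $n$ is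 the minimal natural number with $\mathcal D^{\le -n}\subseteq\mathcal T^{\le 0}$. For $i\in\mathbb Z$ let $\mathcal D_i$ be the $t$-structure with co-aisle $\mathcal D^{\ge -i}\cap\mathcal T^{\ge 0}$, let $\mathcal H_i$ be its heart, and let $(\mathcal X_i,\mathcal Y_i)=(\mathcal D_{i+1}^{\le 0}\cap\mathcal H_i,\ \mathcal D_{i+1}^{\ge 1}\cap\mathcal H_i)$, which is a torsion pair in $\mathcal H_i$. Given $X\in\mathcal H_{\mathcal D}$, its right $t$-tree consists of objects $X_{i_1\dots i_\ell}$ of $\mathcal C$, for $0\le\ell\le n$ and $i_1,\dots,i_\ell\in\{0,1\}$, with root $X$ (the vertex for $\ell=0$), and, for every $\ell<n$ and every vertex $X_{i_1\dots i_\ell}$, with $s=i_1+\dots+i_\ell$, a short exact sequence $$0\to X_{i_1\dots i_\ell 0}\to X_{i_1\dots i_\ell}\to X_{i_1\dots i_\ell 1}\to 0\quad\text{in }\mathcal H_\ell[-s]$$ with $X_{i_1\dots i_\ell 0}\in\mathcal X_\ell[-s]$ and $X_{i_1\dots i_\ell 1}\in\mathcal Y_\ell[-s]$. Such a tree exists and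 is unique up to isomorphism. **Proposition.** Let $X\in\mathcal H_{\mathcal D}$. For each $0\le\ell\le n$ and each vertex $X_{i_1\dots i_\ell}$ of the right $t$-tree of $X$, with $s=i_1+\dots+i_\ell$: 1. $X_{i_1\dots i_\ell}$ belongs to $\mathcal T^{[s,\,n-\ell+s]}$, and $\mathcal T^{[s,\,n-\ell+s]}\subseteq\mathcal T^{[0,n]}$; 2. $H^{s}_{\mathcal T}(X_{i_1\dots i_\ell})\cong X_{i_1\dots i_\ell\,0\cdots0}[s]$, with $n-\ell$ zeros appended; 3. $H^{n-\ell+s}_{\mathcal T}(X_{i_1\dots i_\ell})\cong X_{i_1\dots i_\ell\,1\cdots1}[n-\ell+s]$, with $n-\ell$ ones appended. -/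

import Mathlib

open CategoryTheory CategoryTheory.Limits CategoryTheory.Pretriangulated
  CategoryTheory.Triangulated

universe v u

namespace CategoryTheory.Triangulated.TStructure

section Definitions

variable {C : Type u} [Category.{v} C] [Preadditive C] [HasZeroObject C] [HasShift C ℤ]
  [∀ n : ℤ, (shiftFunctor C n).Additive] [Pretriangulated C]

/-- `D.interval a b` is the class `D^{[a,b]} = D^{≥ a} ∩ D^{≤ b}`. -/
def interval (D : TStructure C) (a b : ℤ) : ObjectProperty C := D.ge a ⊓ D.le b

/-- The cohomological functor `H^i_T`, given by `H^0_T = τ^{≥ 0} τ^{≤ 0}` and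
`H^i_T(X) = H^0_T(X[i])`. It is regarded as a functor to the ambient category; its values lie in
the heart of `T`, which is a full subcategory. -/
noncomputable def tCohomology (T : TStructure C) (i : ℤ) : C ⥤ C :=
  shiftFunctor C i ⋙ T.truncLE 0 ⋙ T.truncGE 0

/-- The pair `(D, T)` is of type `(n, k)`, i.e. has gap `n` and shift `k`: `k` is the maximal
integer with `T^{≤ k} ⊆ D^{≤ 0}`, and `n` is the minimal natural number with
`D^{≤ -n} ⊆ T^{≤ k}`. -/
def IsOfType (D T : TStructure C) (n : ℕ) (k : ℤ) : Prop :=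
  IsGreatest {j : ℤ | T.le j ≤ D.le 0} k ∧ IsLeast {m : ℕ | D.le (-(m : ℤ)) ≤ T.le k} n

/-- A class of objects is a co-aisle if it is the class `E^{≥ 0}` of some t-structure `E`. -/
def IsCoaisle (P : ObjectProperty C) : Prop := ∃ E : TStructure C, E.ge 0 = P

/-- The pair `(D, T)` is right filterable: each `D^{≥ i} ∩ T^{≥ 0}` is a co-aisle. -/
def RightFilterable (D T : TStructure C) : Prop :=
  ∀ i : ℤ, IsCoaisle (D.ge i ⊓ T.ge 0)

namespace RightFilterable

variable {D T : TStructure C} (h : D.RightFilterable T)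

/-- The right basic t-structure `D_i` of `(D, T)`: the t-structure with co-aisle
`D^{≥ -i} ∩ T^{≥ 0}` (a t-structure is determined by its co-aisle). -/
noncomputable def basic (i : ℤ) : TStructure C := (h (-i)).choose

lemma basic_ge_zero (i : ℤ) : (h.basic i).ge 0 = D.ge (-i) ⊓ T.ge 0 :=
  (h (-i)).choose_spec

/-- The right basic heart `H_i`. -/
noncomputable def basicHeart (i : ℤ) : ObjectProperty C := (h.basic i).heart

/-- The right basic torsion class `X_i = D_{i+1}^{≤ 0} ∩ H_i`. -/
noncomputable def torsionClass (i : ℤ) : ObjectProperty C :=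
  (h.basic (i + 1)).le 0 ⊓ h.basicHeart i

/-- The right basic torsion-free class `Y_i = D_{i+1}^{≥ 1} ∩ H_i`. -/
noncomputable def torsionFreeClass (i : ℤ) : ObjectProperty C :=
  (h.basic (i + 1)).ge 1 ⊓ h.basicHeart i

end RightFilterable

/-- `0 → X₁ → X₂ → X₃ → 0` is a short exact sequence in the full subcategory of `C` given
by `P`. -/
def ShortExactIn (P : ObjectProperty C) {X₁ X₂ X₃ : C} (f : X₁ ⟶ X₂) (g : X₂ ⟶ X₃) : Prop :=
  ∃ (h₁ : P X₁) (h₂ : P X₂) (h₃ : P X₃) (w : f ≫ g = 0),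
    (ShortComplex.mk (C := P.FullSubcategory) (X₁ := ⟨X₁, h₁⟩) (X₂ := ⟨X₂, h₂⟩) (X₃ := ⟨X₃, h₃⟩)
      (ObjectProperty.homMk f) (ObjectProperty.homMk g)
      (ObjectProperty.hom_ext P w)).ShortExact

/-- The degree `i₁ + ⋯ + i_ℓ` of a binary word `i₁ … i_ℓ`. -/
def wordDegree (w : List (Fin 2)) : ℤ := ((w.map Fin.val).sum : ℕ)

/-- A right t-tree of height `n` of the object `X`, for the right filterable pair `(D, T)`.
The vertices are indexed by the binary words `w = i₁ … i_ℓ` with `ℓ ≤ n` (the values of `vertex`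
at longer words are irrelevant), the root is `X`, and for `ℓ < n`, writing `s = i₁ + ⋯ + i_ℓ`,
`0 → X_{w0} → X_w → X_{w1} → 0` is the short exact sequence in `H_ℓ[-s]` that decomposes `X_w`
with respect to the torsion pair `(X_ℓ[-s], Y_ℓ[-s])`.
For a class `P` stable under isomorphisms, `P.shift s` is the class `P[-s]` of the
objects `Z` such that `Z[s]` is in `P`. -/
structure RightTTree {D T : TStructure C} (h : D.RightFilterable T) (n : ℕ) (X : C) where
  /-- the vertex `X_w` -/
  vertex : List (Fin 2) → C
  /-- the root is `X` -/
  root : vertex [] ≅ X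
  /-- the inclusion `X_{w0} ↪ X_w` -/
  incl (w : List (Fin 2)) (hw : w.length < n) : vertex (w ++ [0]) ⟶ vertex w
  /-- the projection `X_w ↠ X_{w1}` -/
  proj (w : List (Fin 2)) (hw : w.length < n) : vertex w ⟶ vertex (w ++ [1])
  shortExact (w : List (Fin 2)) (hw : w.length < n) :
    ShortExactIn ((h.basicHeart w.length).shift (wordDegree w)) (incl w hw) (proj w hw)
  torsion (w : List (Fin 2)) (hw : w.length < n) :
    (h.torsionClass w.length).shift (wordDegree w) (vertex (w ++ [0]))
  torsionFree (w : List (Fin 2)) (hw : w.length < n) :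
    (h.torsionFreeClass w.length).shift (wordDegree w) (vertex (w ++ [1]))

end Definitions

end CategoryTheory.Triangulated.TStructure

namespace CategoryTheory.Triangulated.TStructure

section Existence

variable {C : Type u} [Category.{v} C] [Preadditive C] [HasZeroObject C] [HasShift C ℤ]
  [∀ n : ℤ, (shiftFunctor C n).Additive] [Pretriangulated C]

lemma heart_shift_iff (E : TStructure C) (s : ℤ) (Y : C) :
    E.heart.shift s Y ↔ E.le s Y ∧ E.ge s Y := by
  rw [← E.shift_le s 0 s (by lia), ← E.shift_ge s 0 s (by lia)]
  rfl

lemma le_of_ge (E F : TStructure C) {a b : ℤ} (h : E.ge (a + 1) ≤ F.ge (b + 1)) :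
    F.le b ≤ E.le a := by
  intro Y hY
  rw [le_iff_isLE] at hY ⊢
  rw [E.isLE_iff_orthogonal a (a + 1) rfl]
  intro Z f hZ
  have : F.IsGE Z (b + 1) := ⟨h _ hZ.ge⟩
  exact F.zero f b (b + 1)

lemma RightFilterable.basic_ge {D T : TStructure C} (h : D.RightFilterable T) (i m : ℤ) :
    (h.basic i).ge m = D.ge (m - i) ⊓ T.ge m := by
  rw [← (h.basic i).shift_ge m 0 m (by lia), h.basic_ge_zero,
    ← D.shift_ge m (-i) (m - i) (by lia), ← T.shift_ge m 0 m (by lia)]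
  rfl

lemma shortExactIn_of_distTriang (E : TStructure C) (s : ℤ) {X₁ X₂ X₃ : C} (f : X₁ ⟶ X₂)
    (g : X₂ ⟶ X₃) (d : X₃ ⟶ X₁⟦(1 : ℤ)⟧) (hT : Triangle.mk f g d ∈ distTriang C)
    (h₁ : E.heart.shift s X₁) (h₂ : E.heart.shift s X₂) (h₃ : E.heart.shift s X₃) :
    ShortExactIn (E.heart.shift s) f g := by
  have w : f ≫ g = 0 := comp_distTriang_mor_zero₁₂ _ hT
  refine ⟨h₁, h₂, h₃, w, ?_⟩
  have hf : ∀ {Z : C} (_ : E.heart.shift s Z) (k k' : Z ⟶ X₁), k ≫ f = k' ≫ f → k = k' := by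
    intro Z hZ k k' e
    obtain ⟨l, hl⟩ := Triangle.coyoneda_exact₂ _ (inv_rot_of_distTriang _ hT) (k - k')
      ((Preadditive.sub_comp _ _ _).trans (sub_eq_zero.2 e))
    have : l = 0 := by
      have a1 : E.IsLE Z s := ⟨((heart_shift_iff E s Z).1 hZ).1⟩
      have a2 : E.IsGE X₃ s := ⟨((heart_shift_iff E s X₃).1 h₃).2⟩
      have := E.isGE_shift X₃ s (-1) (s + 1)
      exact E.zero (Y := X₃⟦(-1 : ℤ)⟧) l s (s + 1)
    rw [this, zero_comp] at hl
    exact sub_eq_zero.1 hl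
  have hg : ∀ {Z : C} (_ : E.heart.shift s Z) (k k' : X₃ ⟶ Z), g ≫ k = g ≫ k' → k = k' := by
    intro Z hZ k k' e
    obtain ⟨l, hl⟩ := Triangle.yoneda_exact₃ _ hT (k - k')
      ((Preadditive.comp_sub _ _ _).trans (sub_eq_zero.2 e))
    have : l = 0 := by
      have a1 : E.IsGE Z s := ⟨((heart_shift_iff E s Z).1 hZ).2⟩
      have a2 : E.IsLE X₁ s := ⟨((heart_shift_iff E s X₁).1 h₁).1⟩
      have := E.isLE_shift X₁ s 1 (s - 1)
      exact E.zero (X := X₁⟦(1 : ℤ)⟧) l (s - 1) s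
    rw [this, comp_zero] at hl
    exact sub_eq_zero.1 hl
  set S := ShortComplex.mk (C := (E.heart.shift s).FullSubcategory) (X₁ := ⟨X₁, h₁⟩)
    (X₂ := ⟨X₂, h₂⟩) (X₃ := ⟨X₃, h₃⟩) (ObjectProperty.homMk f) (ObjectProperty.homMk g)
      (ObjectProperty.hom_ext _ w) with hS
  have : (E.heart.shift s).ContainsZero := ⟨(HasZeroObject.zero' C).zero, isZero_zero C, by
    rw [heart_shift_iff]
    exact ⟨(E.isLE_of_isZero (isZero_zero C) s).le, (E.isGE_of_isZero (isZero_zero C) s).ge⟩⟩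
  have mf : Mono S.f := ⟨fun k k' e ↦ ObjectProperty.hom_ext _
    (hf (ObjectProperty.FullSubcategory.property _) _ _ (congrArg (fun z ↦ z.hom) e))⟩
  have eg : Epi S.g := ⟨fun k k' e ↦ ObjectProperty.hom_ext _
    (hg (ObjectProperty.FullSubcategory.property _) _ _ (congrArg (fun z ↦ z.hom) e))⟩
  have kf : ∀ {Z : (E.heart.shift s).FullSubcategory} (k : Z ⟶ S.X₂), k ≫ S.g = 0 →
      ∃ l : Z ⟶ S.X₁, l ≫ S.f = k := by
    intro Z k e
    obtain ⟨l, hl⟩ := Triangle.coyoneda_exact₂ _ hT k.hom (congrArg (fun z ↦ z.hom) e)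
    exact ⟨ObjectProperty.homMk l, ObjectProperty.hom_ext _ hl.symm⟩
  have cg : ∀ {Z : (E.heart.shift s).FullSubcategory} (k : S.X₂ ⟶ Z), S.f ≫ k = 0 →
      ∃ l : S.X₃ ⟶ Z, S.g ≫ l = k := by
    intro Z k e
    obtain ⟨l, hl⟩ := Triangle.yoneda_exact₂ _ hT k.hom (congrArg (fun z ↦ z.hom) e)
    exact ⟨ObjectProperty.homMk l, ObjectProperty.hom_ext _ hl.symm⟩
  have hk : IsLimit (KernelFork.ofι S.f S.zero) := KernelFork.IsLimit.ofι _ _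
    (fun k e ↦ (kf k e).choose) (fun k e ↦ (kf k e).choose_spec)
    (fun k e m hm ↦ by rw [← cancel_mono S.f, hm, (kf k e).choose_spec])
  have hc : IsColimit (CokernelCofork.ofπ S.g S.zero) := CokernelCofork.IsColimit.ofπ _ _
    (fun k e ↦ (cg k e).choose) (fun k e ↦ (cg k e).choose_spec)
    (fun k e m hm ↦ by rw [← cancel_epi S.g, hm, (cg k e).choose_spec])
  let Z : (E.heart.shift s).FullSubcategory :=
    (HasZeroObject.zero' _).zero
  have hZ : IsZero Z := isZero_zero _
  have e₁ : hk.lift (KernelFork.ofι S.f S.zero) = 𝟙 _ := by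
    rw [← cancel_mono S.f, Category.id_comp]
    exact hk.fac (KernelFork.ofι S.f S.zero) WalkingParallelPair.zero
  have e₂ : hc.desc (CokernelCofork.ofπ S.g S.zero) = 𝟙 _ := by
    rw [← cancel_epi S.g]
    refine Eq.trans ?_ (Category.comp_id S.g).symm
    exact hc.fac (CokernelCofork.ofπ S.g S.zero) WalkingParallelPair.one
  let L : S.LeftHomologyData :=
    { K := S.X₁, H := Z, i := S.f, π := 0, wi := S.zero, hi := hk, wπ := comp_zero
      hπ := CokernelCofork.IsColimit.ofEpiOfIsZero _ (by rw [e₁]; infer_instance) hZ }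
  let R : S.RightHomologyData :=
    { Q := S.X₃, H := Z, p := S.g, ι := 0, wp := S.zero, hp := hc, wι := zero_comp
      hι := KernelFork.IsLimit.ofMonoOfIsZero _ (by
        rw [e₂]
        exact inferInstanceAs (Mono (𝟙 S.X₃))) hZ }
  exact ⟨⟨⟨⟨L, R, Iso.refl _, by simp [L, R, S.zero]⟩, hZ⟩⟩⟩

/-- One step of the construction of the right t-tree: the decomposition of an object of
`H_i[-s]` with respect to the shifted torsion pair `(X_i[-s], Y_i[-s])`. -/
lemma RightFilterable.exists_decomposition {D T : TStructure C} (h : D.RightFilterable T)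
    (i s : ℤ) (Y : C) (hY : (h.basicHeart i).shift s Y) :
    ∃ (A B : C) (f : A ⟶ Y) (g : Y ⟶ B), ShortExactIn ((h.basicHeart i).shift s) f g ∧
      (h.torsionClass i).shift s A ∧ (h.torsionFreeClass i).shift s B ∧
      (h.basicHeart (i + 1)).shift s A ∧ (h.basicHeart (i + 1)).shift (s + 1) B := by
  set E := h.basic i with hE
  set F := h.basic (i + 1) with hF
  have i₁ : ∀ m, E.ge m ≤ F.ge m := fun m Z hZ ↦ by
    rw [hE, h.basic_ge] at hZ
    rw [hF, h.basic_ge]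
    exact ⟨D.ge_antitone (by lia) _ hZ.1, hZ.2⟩
  have i₂ : ∀ m, F.ge (m + 1) ≤ E.ge m := fun m Z hZ ↦ by
    rw [hF, h.basic_ge] at hZ
    rw [hE, h.basic_ge]
    exact ⟨D.ge_antitone (by lia) _ hZ.1, T.ge_antitone (by lia) _ hZ.2⟩
  have i₃ : ∀ m, F.le m ≤ E.le m := fun m ↦ le_of_ge E F (i₁ _)
  have i₄ : ∀ m, E.le m ≤ F.le (m + 1) := fun m ↦ le_of_ge F E (i₂ _)
  obtain ⟨A, B, hA, hB, f, g, d, hT⟩ := F.exists_triangle Y s (s + 1) rfl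
  obtain ⟨y₁, y₂⟩ := (heart_shift_iff E s Y).1 hY
  have hB₁ : E.ge s B := i₂ s _ hB
  have hA₁ : E.le s A := i₃ s _ hA
  have hA₂ : E.ge s A := by
    rw [ge_iff_isGE]
    exact E.isGE₂ _ (inv_rot_of_distTriang _ hT) s
      ⟨E.ge_antitone (by lia) _ (E.ge_shift s (-1) (s + 1) (by lia) _ hB₁)⟩ ⟨y₂⟩
  have hB₂ : E.le s B := by
    rw [le_iff_isLE]
    exact E.isLE₂ _ (rot_of_distTriang _ hT) s ⟨y₁⟩
      ⟨E.le_monotone (by lia) _ (E.le_shift s 1 (s - 1) (by lia) _ hA₁)⟩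
  have hA' := (heart_shift_iff E s A).2 ⟨hA₁, hA₂⟩
  have hB' := (heart_shift_iff E s B).2 ⟨hB₂, hB₁⟩
  exact ⟨A, B, f, g, shortExactIn_of_distTriang E s f g d hT hA' hY hB',
    ⟨F.le_shift s s 0 (by lia) _ hA, hA'⟩, ⟨F.ge_shift (s + 1) s 1 (by lia) _ hB, hB'⟩,
    (heart_shift_iff F s A).2 ⟨hA, i₁ _ _ hA₂⟩,
    (heart_shift_iff F (s + 1) B).2 ⟨i₄ _ _ hB₂, hB⟩⟩

/-- Every object of the heart of `D` has a right t-tree. -/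
theorem RightTTree.nonempty {D T : TStructure C} (h : D.RightFilterable T) (n : ℕ)
    (hn : D.IsOfType T n 0) (X : C) (hX : D.heart X) : Nonempty (RightTTree h n X) := by
  classical
  have h₀ : (h.basicHeart 0).shift (0 : ℤ) X := by
    have hDT : D.ge 1 ≤ T.ge 1 := fun Z hZ ↦ by
      rw [ge_iff_isGE, T.isGE_iff_orthogonal 0 1 rfl]
      intro W f hW
      exact D.zero' f (hn.1.1 _ hW.le) hZ
    have hg : ∀ m, (h.basic 0).ge m = D.ge m := fun m ↦ by
      rw [h.basic_ge, sub_zero, inf_eq_left, ← D.shift_ge (m - 1) 1 m (by lia),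
        ← T.shift_ge (m - 1) 1 m (by lia)]
      exact fun Z hZ ↦ hDT _ hZ
    refine (heart_shift_iff _ 0 X).2 ⟨?_, ?_⟩
    · exact le_of_ge (h.basic 0) D (hg _).le _ hX.1
    · rw [hg]
      exact hX.2
  have step : ∀ (i s : ℤ) (Y : C), ∃ (A B : C), (h.basicHeart i).shift s Y →
      ∃ (f : A ⟶ Y) (g : Y ⟶ B), ShortExactIn ((h.basicHeart i).shift s) f g ∧
      (h.torsionClass i).shift s A ∧ (h.torsionFreeClass i).shift s B ∧
      (h.basicHeart (i + 1)).shift s A ∧ (h.basicHeart (i + 1)).shift (s + 1) B := by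
    intro i s Y
    by_cases hY : (h.basicHeart i).shift s Y
    · obtain ⟨A, B, r⟩ := h.exists_decomposition i s Y hY
      exact ⟨A, B, fun _ ↦ r⟩
    · exact ⟨Y, Y, fun h' ↦ (hY h').elim⟩
  choose A B hAB using step
  let V : List (Fin 2) → C := fun r ↦ List.rec X
    (fun j r Y ↦ if j = 0 then A r.length (wordDegree r) Y else B r.length (wordDegree r) Y) r
  have hV₀ : ∀ r, V (0 :: r) = A r.length (wordDegree r) (V r) := fun r ↦ rfl
  have hV₁ : ∀ r, V (1 :: r) = B r.length (wordDegree r) (V r) := fun r ↦ rfl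
  have hd : ∀ w : List (Fin 2), wordDegree w.reverse = wordDegree w := fun w ↦ by
    simp [wordDegree]
  have hV : ∀ r, (h.basicHeart r.length).shift (wordDegree r) (V r) := by
    intro r
    induction r with
    | nil => exact h₀
    | cons j r ih =>
      obtain ⟨_, _, _, _, _, a, b⟩ := hAB _ _ _ ih
      have hl : ((j :: r).length : ℤ) = r.length + 1 := by simp
      rw [hl]
      fin_cases j
      · have : wordDegree (0 :: r) = wordDegree r := by simp [wordDegree]
        simpa only [Fin.zero_eta, this, hV₀] using a
      · have : wordDegree (1 :: r) = wordDegree r + 1 := by simp [wordDegree, add_comm]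
        simpa only [Fin.mk_one, this, hV₁] using b
  have key : ∀ w : List (Fin 2), ∃ (f : V (w ++ [0]).reverse ⟶ V w.reverse)
      (g : V w.reverse ⟶ V (w ++ [1]).reverse),
      ShortExactIn ((h.basicHeart w.length).shift (wordDegree w)) f g ∧
      (h.torsionClass w.length).shift (wordDegree w) (V (w ++ [0]).reverse) ∧
      (h.torsionFreeClass w.length).shift (wordDegree w) (V (w ++ [1]).reverse) := by
    intro w
    have r := hAB _ _ _ (hV w.reverse)
    rw [List.reverse_concat, List.reverse_concat, hV₀, hV₁]
    rw [List.length_reverse, hd] at r ⊢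
    obtain ⟨f, g, r₁, r₂, r₃, -⟩ := r
    exact ⟨f, g, r₁, r₂, r₃⟩
  choose f g h₁ h₂ h₃ using key
  exact ⟨⟨fun w ↦ V w.reverse, Iso.refl _, fun w _ ↦ f w, fun w _ ↦ g w, fun w _ ↦ h₁ w,
    fun w _ ↦ h₂ w, fun w _ ↦ h₃ w⟩⟩

end Existence

end CategoryTheory.Triangulated.TStructure

/-!
The basic t-structures interpolate between `D_0 = D` and `D_n = T`, and
`D_i^{≤ m} ⊆ D_{i+1}^{≤ m+1}`, `D_i^{≥ m} ⊆ D_{i+1}^{≥ m}`. A vertex `X_w` of length `ℓ` and degree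
`s` lies in `H_ℓ[-s]`, hence in `T^{[s, n-ℓ+s]}`. A short exact sequence in `H_ℓ[-s]` is a
distinguished triangle, so `X_{w0} → X_w → X_{w1}` induces long exact sequences of `T`-cohomology.
Since `X_{w1}` lies in `T^{≥ s+1}` and `X_{w0}` in `T^{≤ n-ℓ-1+s}`, the lowest cohomology `H^s` is
carried along `X_{w0} → X_w` and the highest one `H^{n-ℓ+s}` along `X_w → X_{w1}`. Following
the all-zeros, respectively all-ones, branch ends at a leaf, which is a single shifted object of
the heart of `T`.
-/

namespace TTreeCohomology

open CategoryTheory.Triangulated.TStructure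

variable {C : Type u} [Category.{v} C] [Preadditive C] [HasZeroObject C] [HasShift C ℤ]
  [∀ n : ℤ, (shiftFunctor C n).Additive] [Pretriangulated C]

lemma distTriang_of_iso₁ {X X' Y Z : C} {f : X ⟶ Y} {g : Y ⟶ Z} {δ : Z ⟶ X⟦(1 : ℤ)⟧}
    (hT : Triangle.mk f g δ ∈ distTriang C) (e : X' ≅ X) :
    Triangle.mk (e.hom ≫ f) g (δ ≫ e.inv⟦(1 : ℤ)⟧') ∈ distTriang C := by
  refine isomorphic_distinguished _ hT _ (Triangle.isoMk _ _ e (Iso.refl _) (Iso.refl _) ?_ ?_ ?_)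
  · exact Category.comp_id _
  · exact (Category.comp_id g).trans (Category.id_comp g).symm
  · change (δ ≫ e.inv⟦(1 : ℤ)⟧') ≫ e.hom⟦(1 : ℤ)⟧' = 𝟙 Z ≫ δ
    simp [← Functor.map_comp]

section AbelianSubcategory

open AbelianSubcategory

lemma exists_distTriang_of_shortExact [IsTriangulated C] {A : Type*} [Category* A] [Preadditive A]
    [HasFiniteProducts A] {ι : A ⥤ C} [ι.Full] [ι.Faithful] [ι.Additive]
    (hι : ∀ ⦃X Y : A⦄ ⦃n : ℤ⦄ (f : ι.obj X ⟶ (ι.obj Y)⟦n⟧), n < 0 → f = 0)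
    (hA : admissibleMorphism ι = ⊤) {S : ShortComplex A} (hS : S.ShortExact) :
    ∃ δ, Triangle.mk (ι.map S.f) (ι.map S.g) δ ∈ distTriang C := by
  have : Balanced A := letI := abelian ι hι hA; inferInstance
  have := hS.mono_f
  have := hS.epi_g
  obtain ⟨K, i, δ, hT⟩ := exists_distinguished_triangle_of_epi hι hA S.g
  let e : S.X₁ ≅ K :=
    IsLimit.conePointUniqueUpToIso hS.fIsKernel (isLimitKernelForkOfDistTriang hι i S.g δ hT)
  have he : e.hom ≫ i = S.f :=
    IsLimit.conePointUniqueUpToIso_hom_comp hS.fIsKernel _ WalkingParallelPair.zero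
  rw [← he, ι.map_comp]
  exact ⟨_, distTriang_of_iso₁ hT (ι.mapIso e)⟩

lemma hasFiniteProducts_of_isTriangulatedClosed₂ (P : ObjectProperty C) [P.ContainsZero]
    [P.IsClosedUnderIsomorphisms] [P.IsTriangulatedClosed₂] :
    HasFiniteProducts P.FullSubcategory := by
  have : P.IsClosedUnderBinaryProducts :=
    { limitsOfShape_le := by
        rintro X ⟨p⟩
        exact P.prop_of_iso
          (IsLimit.conePointUniqueUpToIso (prodIsProd _ _)
            ((IsLimit.postcomposeHomEquiv (diagramIsoPair p.diag) _).2 p.isLimit))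
          (P.ext_of_isTriangulatedClosed₂ _ (binaryProductTriangle_distinguished _ _)
            (p.prop_diag_obj (.mk .left)) (p.prop_diag_obj (.mk .right))) }
  have : P.IsClosedUnderFiniteProducts := .mk'
  infer_instance

end AbelianSubcategory

section ShiftedHeart

variable (E : TStructure C)

lemma heart_shift_eq_interval (s : ℤ) : E.heart.shift s = E.interval s s := by
  ext Y
  exact (heart_shift_iff E s Y).trans and_comm

instance (a b : ℤ) : (E.interval a b).IsClosedUnderIsomorphisms :=
  inferInstanceAs (E.ge a ⊓ E.le b).IsClosedUnderIsomorphisms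

instance (a b : ℤ) : (E.interval a b).ContainsZero where
  exists_zero := ⟨(HasZeroObject.zero' C).zero, isZero_zero C,
    (E.isGE_of_isZero (isZero_zero C) a).ge, (E.isLE_of_isZero (isZero_zero C) b).le⟩

instance (a b : ℤ) : (E.interval a b).IsTriangulatedClosed₂ := .mk' fun Δ hΔ h₁ h₃ ↦
  ⟨(E.isGE₂ Δ hΔ a ⟨h₁.1⟩ ⟨h₃.1⟩).ge, (E.isLE₂ Δ hΔ b ⟨h₁.2⟩ ⟨h₃.2⟩).le⟩

lemma hom_shift_eq_zero {a b n : ℤ} (hn : n < a - b) {X Y : C} (hX : E.le b X) (hY : E.ge a Y)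
    (f : X ⟶ Y⟦n⟧) : f = 0 := by
  have : E.IsLE X b := ⟨hX⟩
  have : E.IsGE (Y⟦n⟧) (a - n) := ⟨E.ge_shift a n (a - n) (by lia) _ hY⟩
  exact E.zero f b (a - n)

variable [IsTriangulated C]

lemma admissibleMorphism_interval_ι (s : ℤ) :
    AbelianSubcategory.admissibleMorphism (E.interval s s).ι = ⊤ := by
  ext X₁ X₂ f
  refine iff_of_true (fun X₃ f₂ f₃ hT ↦ ?_) trivial
  have : E.IsLE X₁.obj s := ⟨X₁.property.2⟩
  have : E.IsGE X₁.obj s := ⟨X₁.property.1⟩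
  have := E.isLE_shift X₁.obj s 1 (s - 1)
  have := E.isGE_shift X₁.obj s 1 (s - 1)
  have : E.IsGE X₃ (s - 1) := E.isGE₂ _ (rot_of_distTriang _ hT) (s - 1)
    ⟨E.ge_antitone (by lia) _ X₂.property.1⟩ ‹_›
  have : E.IsLE X₃ s := E.isLE₂ _ (rot_of_distTriang _ hT) s ⟨X₂.property.2⟩
    (E.isLE_of_le (X₁.obj⟦(1 : ℤ)⟧) (s - 1) s)
  -- Truncating the cone `X₃` of `f` yields the kernel `L[-1]` and the cokernel `Q` of `f`.
  let L := (E.truncLE (s - 1)).obj X₃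
  have : E.IsLE (L⟦(-1 : ℤ)⟧) s := E.isLE_shift L (s - 1) (-1) s
  have : E.IsGE (L⟦(-1 : ℤ)⟧) s := E.isGE_shift L (s - 1) (-1) s
  let Q := (E.truncGE s).obj X₃
  exact ⟨⟨L⟦(-1 : ℤ)⟧, E.ge_of_isGE _ _, E.le_of_isLE _ _⟩,
    ⟨Q, E.ge_of_isGE _ _, E.le_of_isLE _ _⟩, _, _, _,
    distTriang_of_iso₁ (E.triangleLEGE_distinguished (s - 1) s (by lia) X₃)
      ((shiftEquiv C (1 : ℤ)).counitIso.app L)⟩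

lemma exists_distTriang_of_shortExactIn {s : ℤ} {X₁ X₂ X₃ : C} {f : X₁ ⟶ X₂} {g : X₂ ⟶ X₃}
    (H : ShortExactIn (E.heart.shift s) f g) : ∃ δ, Triangle.mk f g δ ∈ distTriang C := by
  rw [heart_shift_eq_interval] at H
  obtain ⟨_, _, _, _, hS⟩ := H
  have := hasFiniteProducts_of_isTriangulatedClosed₂ (E.interval s s)
  exact exists_distTriang_of_shortExact
    (fun X Y _ f hn ↦ hom_shift_eq_zero E (by lia) X.property.2 Y.property.1 f)
    (admissibleMorphism_interval_ι E s) hS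

end ShiftedHeart

section Comparison

variable {E F : TStructure C}

lemma ge_le_ge_of_le_le_le {a b : ℤ} (h : F.le b ≤ E.le a) : E.ge (a + 1) ≤ F.ge (b + 1) := by
  intro Y hY
  rw [ge_iff_isGE, F.isGE_iff_orthogonal b (b + 1) rfl]
  intro Z f hZ
  have : E.IsLE Z a := ⟨h _ hZ.le⟩
  have : E.IsGE Y (a + 1) := ⟨hY⟩
  exact E.zero f a (a + 1)

lemma ge_le_ge_add {a b : ℤ} (h : E.ge a ≤ F.ge b) (k : ℤ) : E.ge (a + k) ≤ F.ge (b + k) := by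
  rw [← E.shift_ge k a (a + k) (add_comm k a), ← F.shift_ge k b (b + k) (add_comm k b)]
  exact fun Y hY ↦ h _ hY

lemma eq_of_ge_zero_eq (h : E.ge 0 = F.ge 0) : E = F := by
  have hge : E.ge = F.ge := funext fun m ↦ by
    rw [← E.shift_ge m 0 m (add_zero m), ← F.shift_ge m 0 m (add_zero m), h]
  have hle : E.le = F.le := funext fun m ↦
    le_antisymm (le_of_ge F E (hge ▸ le_rfl)) (le_of_ge E F (hge ▸ le_rfl))
  cases E
  cases F
  cases hge
  cases hle
  rfl

lemma interval_le_interval {a b a' b' : ℤ} (ha : a' ≤ a) (hb : b ≤ b') :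
    E.interval a b ≤ E.interval a' b' :=
  inf_le_inf (E.ge_antitone ha) (E.le_monotone hb)

end Comparison

section RightBasic

variable {D T : TStructure C} (h : D.RightFilterable T)

instance (i : ℤ) : (h.basicHeart i).IsClosedUnderIsomorphisms :=
  inferInstanceAs (h.basic i).heart.IsClosedUnderIsomorphisms

lemma basic_zero (hTD : T.le 0 ≤ D.le 0) : h.basic 0 = D := by
  apply eq_of_ge_zero_eq
  rw [h.basic_ge, sub_zero, inf_eq_left]
  exact ge_le_ge_add (ge_le_ge_of_le_le_le hTD) (-1)

lemma basic_eq {n : ℤ} (hDT : D.le (-n) ≤ T.le 0) : h.basic n = T := by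
  apply eq_of_ge_zero_eq
  rw [h.basic_ge, inf_eq_right]
  have hge : T.ge (0 + 1 + -1) ≤ D.ge (-n + 1 + -1) :=
    ge_le_ge_add (ge_le_ge_of_le_le_le hDT) (-1)
  rwa [add_neg_cancel_right, add_neg_cancel_right, ← zero_sub] at hge

lemma basic_ge_le_basic_ge {i j : ℤ} (hij : i ≤ j) (m : ℤ) :
    (h.basic i).ge m ≤ (h.basic j).ge m := by
  rw [h.basic_ge, h.basic_ge]
  exact inf_le_inf_right _ (D.ge_antitone (by lia))

lemma basic_le_le_basic_le {i j : ℤ} (hij : i ≤ j) (m : ℤ) :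
    (h.basic i).le m ≤ (h.basic j).le (j - i + m) := by
  apply le_of_ge
  rw [h.basic_ge, h.basic_ge]
  exact inf_le_inf (D.ge_antitone (by lia)) (T.ge_antitone (by lia))

lemma basicHeart_shift_le_interval {i j : ℤ} (hij : i ≤ j) (s : ℤ) :
    (h.basicHeart i).shift s ≤ (h.basic j).interval s (j - i + s) := by
  intro Y hY
  obtain ⟨hle, hge⟩ := (heart_shift_iff (h.basic i) s Y).1 hY
  exact ⟨basic_ge_le_basic_ge h hij s _ hge, basic_le_le_basic_le h hij s _ hle⟩

lemma torsionClass_le_basicHeart_succ (i : ℤ) : h.torsionClass i ≤ h.basicHeart (i + 1) :=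
  fun _ hY ↦ ⟨hY.1, basic_ge_le_basic_ge h (by lia) 0 _ hY.2.2⟩

lemma torsionFreeClass_le_basicHeart_succ_shift (i : ℤ) :
    h.torsionFreeClass i ≤ (h.basicHeart (i + 1)).shift (1 : ℤ) := by
  refine fun Y hY ↦ (heart_shift_iff (h.basic (i + 1)) 1 Y).2 ⟨?_, hY.1⟩
  simpa only [add_sub_cancel_left, add_zero] using
    basic_le_le_basic_le h (Int.le_add_one le_rfl) 0 _ hY.2.1

end RightBasic

section Cohomology

-- Shifting a triangle by `n` multiplies its morphisms by the sign `(-1)ⁿ`.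
lemma isIso_map_units_smul_iff {A B : Type*} [Category* A] [Category* B] [Preadditive A]
    (G : A ⥤ B) (ε : ℤˣ) {X Y : A} (f : X ⟶ Y) : IsIso (G.map (ε • f)) ↔ IsIso (G.map f) := by
  obtain rfl | rfl := Int.units_eq_one_or ε
  · rw [one_smul]
  · have hf : (-1 : ℤˣ) • f = (-(Iso.refl X)).hom ≫ f := by simp
    rw [hf, G.map_comp, isIso_comp_left_iff]

variable (T : TStructure C)

lemma nonempty_tCohomology_obj_iso_shift {s : ℤ} {Y : C} (hY : T.interval s s Y) :
    Nonempty ((T.tCohomology s).obj Y ≅ Y⟦s⟧) := by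
  have : T.IsGE (Y⟦s⟧) 0 := ⟨T.ge_shift s s 0 (add_zero s) _ hY.1⟩
  have : T.IsLE (Y⟦s⟧) 0 := ⟨T.le_shift s s 0 (add_zero s) _ hY.2⟩
  exact ⟨(T.truncGE 0).mapIso (asIso ((T.truncLEι 0).app (Y⟦s⟧))) ≪≫
    (asIso ((T.truncGEπ 0).app (Y⟦s⟧))).symm⟩

variable [IsTriangulated C]

lemma isIso₁_tCohomology_map_of_isGE (Δ : Triangle C) (hΔ : Δ ∈ distTriang C) (n₀ n₁ : ℤ)
    (hn : n₀ + 1 = n₁) (h₃ : T.IsGE Δ.obj₃ n₁) : IsIso ((T.tCohomology n₀).map Δ.mor₁) := by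
  have := T.isIso₁_truncLE_map_of_isGE _ (Triangle.shift_distinguished _ hΔ n₀) 0 1 rfl
    (T.isGE_shift Δ.obj₃ n₁ n₀ 1)
  have : IsIso ((T.truncLE 0).map (Δ.mor₁⟦n₀⟧')) := (isIso_map_units_smul_iff _ _ _).1 this
  exact inferInstanceAs (IsIso ((T.truncGE 0).map ((T.truncLE 0).map (Δ.mor₁⟦n₀⟧'))))

lemma isIso₂_tCohomology_map_of_isLE (Δ : Triangle C) (hΔ : Δ ∈ distTriang C) (n₀ n₁ : ℤ)
    (hn : n₀ + 1 = n₁) (h₁ : T.IsLE Δ.obj₁ n₀) : IsIso ((T.tCohomology n₁).map Δ.mor₂) := by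
  have := T.isIso₂_truncGE_map_of_isLE _ (Triangle.shift_distinguished _ hΔ n₁) (-1) 0 rfl
    (T.isLE_shift Δ.obj₁ n₀ n₁ (-1))
  have : IsIso ((T.truncGE 0).map (Δ.mor₂⟦n₁⟧')) := (isIso_map_units_smul_iff _ _ _).1 this
  exact (NatIso.isIso_map_iff (T.truncGELEIsoLEGE 0 0) (Δ.mor₂⟦n₁⟧')).2
    (inferInstanceAs (IsIso ((T.truncLE 0).map ((T.truncGE 0).map (Δ.mor₂⟦n₁⟧')))))

end Cohomology

section WordDegree

lemma wordDegree_concat (w : List (Fin 2)) (i : Fin 2) :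
    wordDegree (w ++ [i]) = wordDegree w + i.val := by
  simp [wordDegree]

lemma wordDegree_concat_zero (w : List (Fin 2)) : wordDegree (w ++ [0]) = wordDegree w := by
  simp [wordDegree_concat]

lemma wordDegree_concat_one (w : List (Fin 2)) : wordDegree (w ++ [1]) = wordDegree w + 1 := by
  simp [wordDegree_concat]

lemma wordDegree_nonneg (w : List (Fin 2)) : 0 ≤ wordDegree w :=
  Int.natCast_nonneg _

lemma wordDegree_le_length (w : List (Fin 2)) : wordDegree w ≤ w.length := by
  induction w using List.reverseRecOn with
  | nil => simp [wordDegree]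
  | append_singleton w i ih =>
    rw [wordDegree_concat, List.length_append, List.length_singleton]
    have := i.is_le
    lia

end WordDegree

section Tree

variable {D T : TStructure C} {h : D.RightFilterable T} {n : ℕ} {X : C}

lemma vertex_mem (tree : RightTTree h n X) (hTD : T.le 0 ≤ D.le 0) (hX : D.heart X)
    {w : List (Fin 2)} (hw : w.length ≤ n) :
    (h.basicHeart w.length).shift (wordDegree w) (tree.vertex w) := by
  induction w using List.reverseRecOn with
  | nil =>
    change (h.basic 0).heart.shift (0 : ℤ) (tree.vertex [])
    rw [basic_zero h hTD]
    exact (heart_shift_iff D 0 _).2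
      ⟨(D.le 0).prop_of_iso tree.root.symm hX.1, (D.ge 0).prop_of_iso tree.root.symm hX.2⟩
  | append_singleton w i _ =>
    have hlt : w.length < n := by simpa using hw
    rw [List.length_append, List.length_singleton, Nat.cast_succ]
    match i with
    | 0 =>
      rw [wordDegree_concat_zero]
      exact torsionClass_le_basicHeart_succ h _ _ (tree.torsion w hlt)
    | 1 =>
      rw [wordDegree_concat_one, ← ObjectProperty.shift_shift _ _ _ _ rfl]
      exact torsionFreeClass_le_basicHeart_succ_shift h _ _ (tree.torsionFree w hlt)

lemma vertex_mem_interval (tree : RightTTree h n X) (hTD : T.le 0 ≤ D.le 0)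
    (hDT : D.le (-(n : ℤ)) ≤ T.le 0) (hX : D.heart X) {w : List (Fin 2)} (hw : w.length ≤ n) :
    T.interval (wordDegree w) (n - w.length + wordDegree w) (tree.vertex w) := by
  have hmem := basicHeart_shift_le_interval h (Int.ofNat_le.2 hw) (wordDegree w) _
    (vertex_mem tree hTD hX hw)
  rwa [basic_eq h hDT] at hmem

lemma nonempty_tCohomology_leaf_iso (tree : RightTTree h n X) (hTD : T.le 0 ≤ D.le 0)
    (hDT : D.le (-(n : ℤ)) ≤ T.le 0) (hX : D.heart X) {w : List (Fin 2)} (hw : w.length = n) :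
    Nonempty ((T.tCohomology (wordDegree w)).obj (tree.vertex w) ≅
      (tree.vertex w)⟦wordDegree w⟧) := by
  have hmem := vertex_mem_interval tree hTD hDT hX hw.le
  rw [hw, sub_self, zero_add] at hmem
  exact nonempty_tCohomology_obj_iso_shift T hmem

variable [IsTriangulated C]

lemma isIso_tCohomology_map_incl (tree : RightTTree h n X) (hTD : T.le 0 ≤ D.le 0)
    (hDT : D.le (-(n : ℤ)) ≤ T.le 0) (hX : D.heart X) {w : List (Fin 2)} (hw : w.length < n) :
    IsIso ((T.tCohomology (wordDegree w)).map (tree.incl w hw)) := by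
  obtain ⟨δ, hΔ⟩ := exists_distTriang_of_shortExactIn _ (tree.shortExact w hw)
  have hge : T.ge (wordDegree (w ++ [1])) (tree.vertex (w ++ [1])) :=
    (vertex_mem_interval tree hTD hDT hX (by simpa using hw)).1
  rw [wordDegree_concat_one] at hge
  exact isIso₁_tCohomology_map_of_isGE T _ hΔ _ _ rfl ⟨hge⟩

lemma isIso_tCohomology_map_proj (tree : RightTTree h n X) (hTD : T.le 0 ≤ D.le 0)
    (hDT : D.le (-(n : ℤ)) ≤ T.le 0) (hX : D.heart X) {w : List (Fin 2)} (hw : w.length < n) :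
    IsIso ((T.tCohomology (n - w.length + wordDegree w)).map (tree.proj w hw)) := by
  obtain ⟨δ, hΔ⟩ := exists_distTriang_of_shortExactIn _ (tree.shortExact w hw)
  have hle : T.le (n - (w ++ [0]).length + wordDegree (w ++ [0])) (tree.vertex (w ++ [0])) :=
    (vertex_mem_interval tree hTD hDT hX (by simpa using hw)).2
  rw [wordDegree_concat_zero, List.length_append, List.length_singleton] at hle
  exact isIso₂_tCohomology_map_of_isLE T _ hΔ _ _ (by lia) ⟨hle⟩

lemma nonempty_tCohomology_iso_append_replicate_zero (tree : RightTTree h n X)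
    (hTD : T.le 0 ≤ D.le 0) (hDT : D.le (-(n : ℤ)) ≤ T.le 0) (hX : D.heart X) (m : ℕ)
    {w : List (Fin 2)} (hw : w.length + m = n) :
    Nonempty ((T.tCohomology (wordDegree w)).obj (tree.vertex w) ≅
      (tree.vertex (w ++ List.replicate m 0))⟦wordDegree w⟧) := by
  induction m generalizing w with
  | zero =>
    rw [List.replicate_zero, List.append_nil]
    exact nonempty_tCohomology_leaf_iso tree hTD hDT hX hw
  | succ m ih =>
    have hlt : w.length < n := by lia
    have := isIso_tCohomology_map_incl tree hTD hDT hX hlt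
    obtain ⟨e⟩ := ih (w := w ++ [0]) (by rw [List.length_append, List.length_singleton]; lia)
    rw [wordDegree_concat_zero, List.append_assoc, List.singleton_append,
      ← List.replicate_succ] at e
    exact ⟨(asIso ((T.tCohomology (wordDegree w)).map (tree.incl w hlt))).symm ≪≫ e⟩

lemma nonempty_tCohomology_iso_append_replicate_one (tree : RightTTree h n X)
    (hTD : T.le 0 ≤ D.le 0) (hDT : D.le (-(n : ℤ)) ≤ T.le 0) (hX : D.heart X) (m : ℕ)
    {w : List (Fin 2)} (hw : w.length + m = n) :
    Nonempty ((T.tCohomology (m + wordDegree w)).obj (tree.vertex w) ≅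
      (tree.vertex (w ++ List.replicate m 1))⟦m + wordDegree w⟧) := by
  induction m generalizing w with
  | zero =>
    rw [Nat.cast_zero, zero_add, List.replicate_zero, List.append_nil]
    exact nonempty_tCohomology_leaf_iso tree hTD hDT hX hw
  | succ m ih =>
    have hlt : w.length < n := by lia
    have hproj := isIso_tCohomology_map_proj tree hTD hDT hX hlt
    rw [show (n - w.length + wordDegree w : ℤ) = (m + 1 : ℕ) + wordDegree w by lia] at hproj
    obtain ⟨e⟩ := ih (w := w ++ [1]) (by rw [List.length_append, List.length_singleton]; lia)
    rw [wordDegree_concat_one, List.append_assoc, List.singleton_append, ← List.replicate_succ,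
      show (m + (wordDegree w + 1) : ℤ) = (m + 1 : ℕ) + wordDegree w by lia] at e
    exact ⟨asIso ((T.tCohomology ((m + 1 : ℕ) + wordDegree w)).map (tree.proj w hlt)) ≪≫ e⟩

end Tree

end TTreeCohomology

open TTreeCohomology TStructure in
theorem mainTheorem9_general {C : Type u} [Category.{v} C] [Preadditive C] [HasZeroObject C]
    [HasShift C ℤ] [∀ n : ℤ, (shiftFunctor C n).Additive] [Pretriangulated C] [IsTriangulated C]
    {D T : TStructure C} {h : D.RightFilterable T} {n : ℕ} (hTD : T.le 0 ≤ D.le 0)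
    (hDT : D.le (-(n : ℤ)) ≤ T.le 0) {X : C} (hX : D.heart X) (tree : RightTTree h n X)
    (w : List (Fin 2)) (hw : w.length ≤ n) :
    (T.interval (wordDegree w) (n - w.length + wordDegree w) (tree.vertex w) ∧
      T.interval (wordDegree w) (n - w.length + wordDegree w) ≤ T.interval 0 n) ∧
    Nonempty ((T.tCohomology (wordDegree w)).obj (tree.vertex w) ≅
      (tree.vertex (w ++ List.replicate (n - w.length) 0))⟦wordDegree w⟧) ∧
    Nonempty ((T.tCohomology (n - w.length + wordDegree w)).obj (tree.vertex w) ≅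
      (tree.vertex (w ++ List.replicate (n - w.length) 1))⟦(n - w.length + wordDegree w : ℤ)⟧) := by
  have hlen := Nat.add_sub_cancel' hw
  have hdeg := wordDegree_le_length w
  refine ⟨⟨vertex_mem_interval tree hTD hDT hX hw,
      interval_le_interval (wordDegree_nonneg w) (by lia)⟩,
    nonempty_tCohomology_iso_append_replicate_zero tree hTD hDT hX _ hlen, ?_⟩
  have hones := nonempty_tCohomology_iso_append_replicate_one tree hTD hDT hX _ hlen
  rwa [Nat.cast_sub hw] at hones

theorem mainTheorem9 {C : Type u} [Category.{v} C] [Preadditive C] [HasZeroObject C]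
    [HasShift C ℤ] [∀ n : ℤ, (shiftFunctor C n).Additive] [Pretriangulated C] [IsTriangulated C]
    (D T : TStructure C) (h : D.RightFilterable T) (n : ℕ) (hn : D.IsOfType T n 0)
    (X : C) (hX : D.heart X) (tree : TStructure.RightTTree h n X)
    (l : ℕ) (hl : l ≤ n) (w : List (Fin 2)) (hw : w.length = l)
    (s : ℤ) (hs : s = TStructure.wordDegree w) :
    (T.interval s (n - l + s) (tree.vertex w) ∧
      T.interval s (n - l + s) ≤ T.interval 0 n) ∧
    Nonempty ((T.tCohomology s).obj (tree.vertex w) ≅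
      (tree.vertex (w ++ List.replicate (n - l) 0))⟦s⟧) ∧
    Nonempty ((T.tCohomology (n - l + s)).obj (tree.vertex w) ≅
      (tree.vertex (w ++ List.replicate (n - l) 1))⟦(n - l + s : ℤ)⟧) := by
  subst hw hs
  exact mainTheorem9_general hn.1.1 hn.2.1 hX tree w hl
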